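/- **Definitions.** A family $\Lambda=\{\lambda_n\}$ of real numbers is *uniformly discrete* if $\inf_{m\neq n}|\lambda_m-\lambda_n|>0$. A system of vectors $\{u_n\}$ in a Hilbert space $H$ is a *(QF)-system* ("quasi-frame") if (i) for every $q>2$ there is a constant $C(q)$ such that for every $f\in H$ and every $\varepsilon>0$ there is a finite linear combination $Q=\sum c_n u_n$ with $$\|f-Q\|<\varepsilon\qquad\text{and}\qquad \Big(\sum|c_n|^q\Big)^{1/q}\le C(q)\,\|f\|;$$ (ii) (Bessel inequality) there is a constant $C'$ such that $\big(\sum|\langle f,u_n\rangle|^2\big)^{1/2}\le C'\|f\|$ for all $f\in H$. It is a *frame* if there are constants $A>0$ and $B$ such that $A\|f\|^2\le\sum|\langle f,u_n\rangle|^2\le B\|f\|^2$ for all $f\in H$. **Theorem 1.** There exist a uniformly discrete sequence $\Lambda=\{\lambda_n\}_{n\in\mathbb{N}}$ of real numbers and a (complex-valued) function $g\in L^2(\mathbb{R})$ such that the family of translates $\{g(t-\lambda)\}_{\lambda\in\Lambda}$ is a (QF)-system for $L^2(\mathbb{R})$. In contrast, for no uniformly discrete $\Lambda\subset\mathbb{R}$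 and no $g\in L^2(\mathbb{R})$ is the family $\{g(t-\lambda)\}_{\lambda\in\Lambda}$ a frame for $L^2(\mathbb{R})$. -/

import Mathlib

open MeasureTheory

noncomputable section

/-- A family of reals is uniformly discrete if its members with different indices are at distance
at least some fixed `δ > 0` from each other. -/
def IsUniformlyDiscrete {ι : Type*} (Λ : ι → ℝ) : Prop :=
  ∃ δ : ℝ, 0 < δ ∧ ∀ m n : ι, m ≠ n → δ ≤ |Λ m - Λ n|

/-- The translate `t ↦ g (t - a)` of `g ∈ L²(ℝ)`, as an element of `L²(ℝ)`. -/
def translateL2 (a : ℝ) (g : Lp ℂ 2 (volume : Measure ℝ)) : Lp ℂ 2 (volume : Measure ℝ) :=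
  Lp.compMeasurePreserving (fun t : ℝ => t - a) (measurePreserving_sub_right volume a) g

section Hilbert

variable {H : Type*} [NormedAddCommGroup H] [InnerProductSpace ℂ H] {ι : Type*}

/-- Completeness with `ℓ_q` estimate of the coefficients, for one exponent `q`: finite linear
combinations `∑ cₙ uₙ` approximate every `f` arbitrarily well under the bound
`‖c‖_{ℓ_q} ≤ C ‖f‖`, with `C` independent of `f` and of the error `ε`. -/
def IsCompleteWithEstimate (u : ι → H) (q : ℝ) : Prop :=
  ∃ C : ℝ, ∀ f : H, ∀ ε : ℝ, 0 < ε → ∃ c : ι →₀ ℂ,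
    ‖f - c.sum (fun n a => a • u n)‖ < ε ∧
      (c.sum (fun _ a => ‖a‖ ^ q)) ^ (1 / q) ≤ C * ‖f‖

/-- Bessel inequality. -/
def IsBessel (u : ι → H) : Prop :=
  ∃ C : ℝ, ∀ f : H, Summable (fun n => ‖inner ℂ (u n) f‖ ^ 2) ∧
    Real.sqrt (∑' n, ‖inner ℂ (u n) f‖ ^ 2) ≤ C * ‖f‖

/-- (QF)-systems ("quasi-frames"). -/
def IsQuasiFrame (u : ι → H) : Prop :=
  (∀ q : ℝ, 2 < q → IsCompleteWithEstimate u q) ∧ IsBessel u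

/-- Frames: two-sided frame inequality. -/
def IsHilbertFrame (u : ι → H) : Prop :=
  ∃ A B : ℝ, 0 < A ∧ ∀ f : H, Summable (fun n => ‖inner ℂ (u n) f‖ ^ 2) ∧
    A * ‖f‖ ^ 2 ≤ ∑' n, ‖inner ℂ (u n) f‖ ^ 2 ∧
    ∑' n, ‖inner ℂ (u n) f‖ ^ 2 ≤ B * ‖f‖ ^ 2

end Hilbert

end

/-! The Fourier transform turns translates of a function into modulations of its transform, so
everything happens on the frequency side.

Existence rests on `exists_trigPoly_tendsto_one`: Riesz-type products `S ^ 2` of mean one, with `S`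
tending to zero almost everywhere, give polynomials `1 - S ^ 2` of high frequency that tend to 1 and
have small `ℓ_q` norms. With `N` factors of amplitude `a`, smallness of `S` needs `N a ^ 2` large,
while the coefficients need `N a ^ q` small; both are possible exactly because `q > 2`. Damping a
Gaussian by a weight (`exists_weight`) turns this into `L²` convergence, so each modulation, and
then by density each vector, is approximated using arbitrarily far frequencies and arbitrarily small
coefficients. Placing such approximations in successive disjoint blocks produces `Λ`.

The Bessel inequality holds because modulated Gaussians with separated frequencies have a Gram
matrix with bounded row sums. The same bound, uniform in the centre of the Gaussian, excludes
frames: the coefficients of a unit bump on `[N, N + 1]` tend to zero in `ℓ_2` as `N` grows. -/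

noncomputable section

open Filter Topology Real
open scoped FourierTransform SchwartzMap ComplexConjugate

/-! ### Finite coefficient families and trigonometric polynomials. -/

/-- The sum `∑ |cₙ|^q` over the support of a finitely supported family. -/
def qsum {ι : Type*} (q : ℝ) (c : ι →₀ ℂ) : ℝ := c.sum fun _ a => ‖a‖ ^ q

/-- The character `x ↦ exp (-2πi a x)`. -/
def modChar (a x : ℝ) : ℂ := Real.fourierChar (-(a * x))

lemma norm_modChar (a x : ℝ) : ‖modChar a x‖ = 1 := Circle.norm_coe _

lemma modChar_add (a b x : ℝ) : modChar (a + b) x = modChar a x * modChar b x := by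
  simp only [modChar]
  rw [← Circle.coe_mul, ← AddChar.map_add_eq_mul]
  ring_nf

lemma modChar_zero (x : ℝ) : modChar 0 x = 1 := by simp [modChar]

lemma continuous_modChar (a : ℝ) : Continuous (modChar a) := by
  unfold modChar
  fun_prop

lemma modChar_eq (a x : ℝ) :
    modChar a x = Real.cos (2 * π * (a * x)) - Real.sin (2 * π * (a * x)) * Complex.I := by
  simp only [modChar, Real.fourierChar_apply]
  rw [Complex.exp_mul_I, ← Complex.ofReal_cos, ← Complex.ofReal_sin]
  simp [mul_neg]
  ring

lemma modChar_add_modChar_neg (a x : ℝ) :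
    modChar a x + modChar (-a) x = ((2 * Real.cos (2 * π * (a * x)) : ℝ) : ℂ) := by
  rw [modChar_eq, modChar_eq]
  simp [mul_neg]
  ring

section qsum

variable {ι : Type*} {q : ℝ}

lemma qsum_nonneg (c : ι →₀ ℂ) : 0 ≤ qsum q c :=
  Finset.sum_nonneg fun _ _ => by positivity

lemma qsum_add_of_disjoint {c d : ι →₀ ℂ} (h : Disjoint c.support d.support) :
    qsum q (c + d) = qsum q c + qsum q d :=
  Finsupp.sum_add_index_of_disjoint h _

lemma qsum_smul (hq : 0 < q) (b : ℂ) (c : ι →₀ ℂ) : qsum q (b • c) = ‖b‖ ^ q * qsum q c := by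
  unfold qsum
  rw [Finsupp.sum_smul_index' (fun _ => by simp [hq.ne']), Finsupp.mul_sum]
  refine Finsupp.sum_congr fun i _ => ?_
  rw [smul_eq_mul, norm_mul, Real.mul_rpow (norm_nonneg _) (norm_nonneg _)]

lemma norm_rpow_le_qsum (c : ι →₀ ℂ) {i : ι} (hi : i ∈ c.support) : ‖c i‖ ^ q ≤ qsum q c :=
  Finset.single_le_sum (f := fun i => ‖c i‖ ^ q) (fun _ _ => by positivity) hi

/-- For coefficients of modulus at most one, `∑ |cₙ|^q` decreases in `q`. -/
lemma qsum_anti {p : ℝ} (hp : 0 < p) (hpq : p ≤ q) {c : ι →₀ ℂ} (hc : qsum p c ≤ 1) :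
    qsum q c ≤ qsum p c := by
  refine Finset.sum_le_sum fun i hi => ?_
  have h1 : ‖c i‖ ≤ 1 := by
    by_contra! h
    exact absurd ((norm_rpow_le_qsum (q := p) c hi).trans hc)
      (not_le.2 (Real.one_lt_rpow h hp))
  exact Real.rpow_le_rpow_of_exponent_ge (by simpa using hi) h1 hpq

end qsum

/-- The trigonometric polynomial with coefficients `c`. -/
def trigPoly (c : ℤ →₀ ℂ) (x : ℝ) : ℂ := c.sum fun n a => a * modChar n x

lemma trigPoly_add (c d : ℤ →₀ ℂ) (x : ℝ) :
    trigPoly (c + d) x = trigPoly c x + trigPoly d x :=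
  Finsupp.sum_add_index' (by simp) (by intros; ring)

lemma trigPoly_smul (b : ℂ) (c : ℤ →₀ ℂ) (x : ℝ) : trigPoly (b • c) x = b * trigPoly c x := by
  unfold trigPoly
  rw [Finsupp.sum_smul_index' (by simp), Finsupp.mul_sum]
  exact Finsupp.sum_congr fun i _ => by rw [smul_eq_mul, mul_assoc]

lemma trigPoly_single (n : ℤ) (a : ℂ) (x : ℝ) :
    trigPoly (Finsupp.single n a) x = a * modChar n x := by
  simp [trigPoly]

lemma continuous_trigPoly (c : ℤ →₀ ℂ) : Continuous (trigPoly c) := by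
  unfold trigPoly Finsupp.sum
  exact continuous_finsetSum _ fun n _ => continuous_const.mul (continuous_modChar _)

/-- Shifting the spectrum by `n`. -/
def shiftCoeff (n : ℤ) (c : ℤ →₀ ℂ) : ℤ →₀ ℂ := Finsupp.equivMapDomain (Equiv.addRight n) c

lemma trigPoly_shiftCoeff (n : ℤ) (c : ℤ →₀ ℂ) (x : ℝ) :
    trigPoly (shiftCoeff n c) x = modChar n x * trigPoly c x := by
  unfold trigPoly shiftCoeff
  rw [Finsupp.sum_equivMapDomain, Finsupp.mul_sum]
  refine Finsupp.sum_congr fun i _ => ?_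
  simp only [Equiv.coe_addRight, Int.cast_add, modChar_add]
  ring

lemma qsum_shiftCoeff (q : ℝ) (n : ℤ) (c : ℤ →₀ ℂ) : qsum q (shiftCoeff n c) = qsum q c := by
  unfold qsum shiftCoeff
  rw [Finsupp.sum_equivMapDomain]

lemma mem_support_shiftCoeff {n m : ℤ} {c : ℤ →₀ ℂ} :
    m ∈ (shiftCoeff n c).support ↔ m - n ∈ c.support := by
  simp [shiftCoeff, sub_eq_add_neg]

/-! ### Riesz products. -/

/-- Coefficients of the product of the trigonometric polynomial of `c` with
`1 + 2 b cos (2πnx) + 2 d cos (4πnx)`. -/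
def rieszStep (b d : ℂ) (n : ℤ) (c : ℤ →₀ ℂ) : ℤ →₀ ℂ :=
  c + (b • shiftCoeff n c + (b • shiftCoeff (-n) c +
    (d • shiftCoeff (2 * n) c + d • shiftCoeff (-(2 * n)) c)))

lemma trigPoly_rieszStep (b d : ℂ) (n : ℤ) (c : ℤ →₀ ℂ) (x : ℝ) :
    trigPoly (rieszStep b d n c) x = trigPoly c x *
      (1 + b * ((2 * Real.cos (2 * π * (n * x)) : ℝ) : ℂ) +
        d * ((2 * Real.cos (2 * π * ((2 * n : ℝ) * x)) : ℝ) : ℂ)) := by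
  simp only [rieszStep, trigPoly_add, trigPoly_smul, trigPoly_shiftCoeff,
    ← modChar_add_modChar_neg]
  push_cast
  ring

lemma mem_support_rieszStep {b d : ℂ} {n m : ℤ} {c : ℤ →₀ ℂ}
    (h : m ∈ (rieszStep b d n c).support) :
    m ∈ c.support ∨ m - n ∈ c.support ∨ m + n ∈ c.support ∨ m - 2 * n ∈ c.support ∨
      m + 2 * n ∈ c.support := by
  by_contra! hm
  have e (k : ℤ) : (shiftCoeff k c) m = c (m - k) := by simp [shiftCoeff, sub_eq_add_neg]
  simp only [Finsupp.mem_support_iff, not_not] at hm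
  rw [Finsupp.mem_support_iff] at h
  apply h
  simp [rieszStep, e, hm]

/-- The five copies of the spectrum lie within `B` of `0`, `±n`, `±2n`; for `n > 2B` they are
disjoint, so the sums add. -/
lemma qsum_rieszStep {q : ℝ} (hq : 0 < q) (b d : ℂ) {n B : ℤ} {c : ℤ →₀ ℂ}
    (hB : ∀ m ∈ c.support, |m| ≤ B) (hn : 2 * B < n) :
    qsum q (rieszStep b d n c) = (1 + 2 * ‖b‖ ^ q + 2 * ‖d‖ ^ q) * qsum q c := by
  have hsub (x : ℂ) (k m : ℤ) (h : m ∈ (x • shiftCoeff k c).support) : |m - k| ≤ B :=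
    hB _ (mem_support_shiftCoeff.1 (Finsupp.support_smul h))
  have hadd {f g : ℤ →₀ ℂ} {p r : ℤ → Prop} (hf : ∀ m ∈ f.support, p m)
      (hg : ∀ m ∈ g.support, r m) : ∀ m ∈ (f + g).support, p m ∨ r m := fun m hm =>
    (Finset.mem_union.1 (Finsupp.support_add hm)).imp (hf m) (hg m)
  have h4 := hsub d (2 * n)
  have h5 := hsub d (-(2 * n))
  have h3 := hsub b (-n)
  have h2 := hsub b n
  have h45 := hadd h4 h5
  have h345 := hadd h3 h45
  have h2345 := hadd h2 h345
  have hdis {f g : ℤ →₀ ℂ} {p r : ℤ → Prop} (hf : ∀ m ∈ f.support, p m)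
      (hg : ∀ m ∈ g.support, r m) (hpr : ∀ m, p m → ¬ r m) : Disjoint f.support g.support :=
    Finset.disjoint_left.2 fun m hm hm' => hpr m (hf m hm) (hg m hm')
  rw [rieszStep, qsum_add_of_disjoint (hdis hB h2345 _), qsum_add_of_disjoint (hdis h2 h345 _),
    qsum_add_of_disjoint (hdis h3 h45 _), qsum_add_of_disjoint (hdis h4 h5 _)]
  · simp only [qsum_smul hq, qsum_shiftCoeff]
    ring
  all_goals
    intro m
    simp only [abs_le]
    omega

/-- Squares of lacunary products of the positive factors `α (1 - a cos (2πnx))`, with mean value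
one: the square root has small integral against a Gaussian while the coefficients remain under
control in every `ℓ_q`. -/
lemma exists_rieszProduct {a q : ℝ} (ha : 0 < a) (ha1 : a ≤ 1) (hq : 0 < q) (M : ℤ) (N : ℕ) :
    ∃ (c : ℤ →₀ ℂ) (S : ℝ → ℝ) (B : ℝ), Continuous S ∧ (∀ x, 0 ≤ S x) ∧ (∀ x, S x ≤ B) ∧
      (∀ x, trigPoly c x = ((S x ^ 2 : ℝ) : ℂ)) ∧ c 0 = 1 ∧
      (∀ m ∈ c.support, m ≠ 0 → M ≤ |m|) ∧
      ∫ x, S x * rexp (-π * x ^ 2) < 2 * (√(1 + a ^ 2 / 2))⁻¹ ^ N ∧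
      qsum q c ≤ (1 + 4 * a ^ q) ^ N := by
  induction N with
  | zero =>
    refine ⟨Finsupp.single 0 1, fun _ => 1, 1, continuous_const, by simp, by simp, ?_, by simp,
      ?_, ?_, ?_⟩
    · intro x
      simp [trigPoly_single, modChar_zero]
    · intro m hm h0
      have := Finsupp.support_single_subset hm
      simp at this
      exact absurd this h0
    · simp only [one_mul, integral_gaussian]
      simp
    · rw [qsum, Finsupp.sum_single_index (by simp [hq.ne'])]
      simp
  | succ N ih =>
    obtain ⟨c, S, B, hSc, hS0, hSB, hcS, hc0, hcM, hSi, hcq⟩ := ih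
    set α : ℝ := (√(1 + a ^ 2 / 2))⁻¹ with hα
    have hα0 : 0 < α := by positivity
    have hα2 : α ^ 2 * (1 + a ^ 2 / 2) = 1 := by
      rw [hα, inv_pow, Real.sq_sqrt (by positivity)]
      field_simp
    have hα1 : α ^ 2 ≤ 1 := by 
      nlinarith [mul_nonneg (sq_nonneg α) (sq_nonneg a)]
    obtain ⟨D, hD⟩ : ∃ D : ℤ, ∀ m ∈ c.support, |m| ≤ D := by
      refine ⟨∑ m ∈ c.support, |m|, fun m hm => ?_⟩
      exact Finset.single_le_sum (f := fun m : ℤ => |m|) (fun _ _ => abs_nonneg _) hm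
    have hD0 : 0 ≤ D := by
      simpa using hD 0 (by simp [hc0])
    have hgi : Integrable fun x => S x * rexp (-π * x ^ 2) := by
      refine (integrable_exp_neg_mul_sq pi_pos).bdd_mul (c := B) hSc.aestronglyMeasurable ?_
      exact Eventually.of_forall fun x => by
        rw [Real.norm_of_nonneg (hS0 x)]
        exact hSB x
    -- Riemann–Lebesgue: the integral is the real part of a Fourier transform at `n`.
    have hcos : Tendsto (fun n : ℕ => ∫ x, S x * rexp (-π * x ^ 2) * Real.cos (2 * π * (n * x)))
        atTop (𝓝 0) := by
      have h := Real.zero_at_infty_fourier (fun x => ((S x * rexp (-π * x ^ 2) : ℝ) : ℂ))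
      have h2 : Tendsto (fun n : ℕ => (n : ℝ)) atTop (cocompact ℝ) :=
        tendsto_natCast_atTop_atTop.mono_right atTop_le_cocompact
      have h3 := (Complex.continuous_re.tendsto 0).comp (h.comp h2)
      simp only [Complex.zero_re] at h3
      refine h3.congr fun n => ?_
      simp only [Function.comp]
      rw [Real.fourier_eq, ← RCLike.re_eq_complex_re, ← integral_re]
      · refine integral_congr_ae (Eventually.of_forall fun x => ?_)
        have h4 : Real.fourierChar (-inner ℝ x (n : ℝ)) = Real.fourierChar (-((n : ℝ) * x)) := by
          simp
        have h5 := modChar_eq n x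
        rw [modChar] at h5
        simp only [h4, Circle.smul_def, h5, smul_eq_mul, RCLike.re_eq_complex_re]
        simp only [Complex.mul_re, Complex.sub_re, Complex.ofReal_re, Complex.ofReal_im,
          Complex.mul_im, Complex.I_re, Complex.I_im, Complex.sub_im]
        ring
      · exact (Real.fourierIntegral_convergent_iff (μ := volume) (n : ℝ)).2 hgi.ofReal
    have hlim : Tendsto (fun n : ℕ => α * (∫ x, S x * rexp (-π * x ^ 2)) - α * a *
        ∫ x, S x * rexp (-π * x ^ 2) * Real.cos (2 * π * (n * x))) atTop
        (𝓝 (α * (∫ x, S x * rexp (-π * x ^ 2)) - α * a * 0)) :=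
      tendsto_const_nhds.sub (hcos.const_mul _)
    -- Each factor multiplies the integral by `α` up to an error vanishing as `n → ∞`; the strict
    -- bound, with room from the initial `1 < 2`, absorbs it.
    have hlt : α * (∫ x, S x * rexp (-π * x ^ 2)) - α * a * 0 < 2 * α ^ (N + 1) := by
      rw [pow_succ]
      nlinarith
    obtain ⟨n, hn1, hn2⟩ := ((hlim.eventually_lt_const hlt).and
      (eventually_ge_atTop (2 * D + D + M.natAbs + 1).toNat)).exists
    -- `n > 2D` keeps the copies disjoint and the constant term equal to 1; `n - D ≥ |M|` makes the
    -- new frequencies high.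
    have hn3 : 2 * D + D + |M| + 1 ≤ (n : ℤ) := by
      have := Int.toNat_le.1 hn2
      simpa using this
    have hab := le_abs_self M
    have hab' := abs_nonneg M
    -- The squared factor is `α²(1 + a²/2) - 2aα² cos θ + (a²α²/2) cos 2θ`. The choice of `α` makes
    -- its constant term 1; the coefficients of `rieszStep` are half the other two.
    refine ⟨rieszStep (-(a * α ^ 2 : ℝ)) ((a ^ 2 * α ^ 2 / 4 : ℝ)) n c,
      fun x => S x * (α * (1 - a * Real.cos (2 * π * (n * x)))), B * (α * (1 + a)), ?_, ?_, ?_,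
      ?_, ?_, ?_, ?_, ?_⟩
    · fun_prop
    · intro x
      have := Real.cos_le_one (2 * π * (n * x))
      have : 0 ≤ 1 - a * Real.cos (2 * π * (n * x)) := by nlinarith
      have := hS0 x
      positivity
    · intro x
      have h1 := Real.cos_le_one (2 * π * (n * x))
      have h2 := Real.neg_one_le_cos (2 * π * (n * x))
      have h3 : 0 ≤ 1 - a * Real.cos (2 * π * (n * x)) := by nlinarith
      refine mul_le_mul (hSB x) ?_ (by positivity) ((hS0 x).trans (hSB x))
      exact mul_le_mul_of_nonneg_left (by nlinarith) hα0.le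
    · intro x
      rw [trigPoly_rieszStep, hcS]
      have h2 : 2 * π * ((2 * n : ℝ) * x) = 2 * (2 * π * (n * x)) := by ring
      simp only [Int.cast_natCast, h2, Real.cos_two_mul]
      set t := Real.cos (2 * π * (n * x))
      rw [← Complex.ofReal_neg]
      norm_cast
      have : (S x * (α * (1 - a * t))) ^ 2 = S x ^ 2 *
          (α ^ 2 * (1 + a ^ 2 / 2) + -(a * α ^ 2) * (2 * t) +
            a ^ 2 * α ^ 2 / 4 * (2 * (2 * t ^ 2 - 1))) := by ring
      rw [this, hα2]
    · have e (k : ℤ) (hk : D < |k|) : (shiftCoeff k c) 0 = 0 := by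
        have : (-k) ∉ c.support := fun h => by
          have := hD _ h
          rw [abs_neg] at this
          omega
        simpa [shiftCoeff] using this
      have hn0 : D < |(n : ℤ)| := by rw [lt_abs]; omega
      have hn1 : D < |2 * (n : ℤ)| := by rw [lt_abs]; omega
      simp [rieszStep, e _ hn0, e _ hn1, e _ ((abs_neg (n : ℤ)).symm ▸ hn0),
        e _ ((abs_neg (2 * (n : ℤ))).symm ▸ hn1), hc0]
    · intro m hm h0
      have := mem_support_rieszStep hm
      rcases this with h | h | h | h | h
      · exact hcM m h h0
      all_goals
        have := abs_le.1 (hD _ h)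
        rw [le_abs]
        omega
    · refine lt_of_eq_of_lt ?_ hn1
      rw [← integral_const_mul, ← integral_const_mul, ← integral_sub]
      · congr 1 with x
        ring
      · exact hgi.const_mul _
      · refine Integrable.const_mul ?_ _
        refine hgi.mul_bdd (c := 1) (by fun_prop) ?_
        exact Eventually.of_forall fun x => Real.abs_cos_le_one _
    · rw [qsum_rieszStep hq _ _ hD (by omega), pow_succ _ N, mul_comm]
      have h1 : ‖-((a * α ^ 2 : ℝ) : ℂ)‖ ≤ a := by
        rw [norm_neg, Complex.norm_real, Real.norm_of_nonneg (by positivity)]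
        nlinarith
      have h2 : ‖((a ^ 2 * α ^ 2 / 4 : ℝ) : ℂ)‖ ≤ a := by
        rw [Complex.norm_real, Real.norm_of_nonneg (by positivity)]
        nlinarith [mul_nonneg ha.le ha.le, sq_nonneg a]
      refine mul_le_mul hcq ?_ (by positivity) (by positivity)
      have h3 := Real.rpow_le_rpow (norm_nonneg _) h1 hq.le
      have h4 := Real.rpow_le_rpow (norm_nonneg _) h2 hq.le
      linarith


/-- Take `a² = K / N`. By Bernoulli, `(1 + a²/2) ^ N ≥ 1 + K/2 > (2/ε)²`, whatever `N`; meanwhile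
`(1 + 4 a ^ q) ^ N ≤ exp (4 K ^ (q/2) N ^ (1 - q/2))`, which tends to 1 as `q > 2`. -/
lemma exists_rieszParameters {q ε : ℝ} (hq : 2 < q) (hε : 0 < ε) :
    ∃ (a : ℝ) (N : ℕ), 0 < a ∧ a ≤ 1 ∧ 2 * (√(1 + a ^ 2 / 2))⁻¹ ^ N < ε ∧
      (1 + 4 * a ^ q) ^ N < 1 + ε := by
  set K : ℝ := 8 / ε ^ 2 with hK
  have hK0 : 0 < K := by positivity
  have h1 : Tendsto (fun N : ℕ => rexp (4 * K ^ (q / 2) * (N : ℝ) ^ (-(q / 2 - 1)))) atTop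
      (𝓝 (rexp (4 * K ^ (q / 2) * 0))) :=
    (Real.continuous_exp.tendsto _).comp (((tendsto_rpow_neg_atTop (by linarith)).comp
      tendsto_natCast_atTop_atTop).const_mul _)
  have h2 : rexp (4 * K ^ (q / 2) * 0) < 1 + ε := by simp [hε]
  obtain ⟨N, hN1, hN2, hN3⟩ := ((h1.eventually_lt_const h2).and
    ((eventually_ge_atTop 1).and (eventually_ge_atTop ⌈K⌉₊))).exists
  have hN0 : (0 : ℝ) < N := by exact_mod_cast hN2
  have hKN : K ≤ N := Nat.ceil_le.1 hN3
  have hsq : √(K / N) ^ 2 = K / N := Real.sq_sqrt (by positivity)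
  refine ⟨√(K / N), N, by positivity, ?_, ?_, ?_⟩
  · exact Real.sqrt_le_one.2 ((div_le_one hN0).2 hKN)
  · rw [hsq, inv_pow, ← div_eq_mul_inv, div_lt_iff₀ (by positivity)]
    have h3 : 1 + K / 2 ≤ (√(1 + K / N / 2) ^ N) ^ 2 := by
      rw [← pow_mul, mul_comm N 2, pow_mul, Real.sq_sqrt (by positivity)]
      have := one_add_mul_le_pow (a := K / N / 2) (by have : 0 ≤ K / N / 2 := by positivity
                                                      linarith) N
      refine le_trans (le_of_eq ?_) this
      field_simp
    have h4 : (2 / ε) ^ 2 < (√(1 + K / N / 2) ^ N) ^ 2 := by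
      refine lt_of_lt_of_le ?_ h3
      rw [hK]
      have : (2 / ε) ^ 2 = 8 / ε ^ 2 / 2 := by ring
      linarith
    have h5 := lt_of_pow_lt_pow_left₀ 2 (by positivity) h4
    rw [div_lt_iff₀ hε] at h5
    linarith
  · refine lt_of_le_of_lt ?_ hN1
    have h3 : 1 + 4 * √(K / N) ^ q ≤ rexp (4 * √(K / N) ^ q) := by
      linarith [Real.add_one_le_exp (4 * √(K / N) ^ q)]
    refine (pow_le_pow_left₀ (by positivity) h3 N).trans (le_of_eq ?_)
    rw [← Real.exp_nat_mul]
    congr 1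
    rw [Real.sqrt_eq_rpow, ← Real.rpow_mul (by positivity), Real.div_rpow hK0.le hN0.le,
      Real.rpow_neg hN0.le, Real.rpow_sub_one hN0.ne']
    rw [show 1 / 2 * q = q / 2 by ring]
    field_simp

/-- Trigonometric polynomials with high frequencies and small `ℓ_q` norms of the coefficients that
converge to `1` almost everywhere. -/
theorem exists_trigPoly_tendsto_one : ∃ c : ℕ → ℤ →₀ ℂ,
    (∀ j, ∀ m ∈ (c j).support, (j : ℤ) ≤ |m|) ∧
    (∀ q : ℝ, 2 < q → Tendsto (fun j => qsum q (c j)) atTop (𝓝 0)) ∧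
    ∀ᵐ x : ℝ, Tendsto (fun j => trigPoly (c j) x) atTop (𝓝 1) := by
  have key (j : ℕ) : ∃ (c : ℤ →₀ ℂ) (S : ℝ → ℝ), Continuous S ∧ (∀ x, 0 ≤ S x) ∧
      Integrable (fun x => S x * rexp (-π * x ^ 2)) ∧
      (∀ x, trigPoly c x = 1 - ((S x ^ 2 : ℝ) : ℂ)) ∧ (∀ m ∈ c.support, (j : ℤ) ≤ |m|) ∧
      ∫ x, S x * rexp (-π * x ^ 2) ≤ (1 / 2) ^ j ∧
      qsum (2 + 1 / (j + 1)) c ≤ (1 / 2) ^ j := by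
    have hq : (2 : ℝ) < 2 + 1 / (j + 1) := by
      have : (0 : ℝ) < 1 / (j + 1) := by positivity
      linarith
    have hq0 : (0 : ℝ) < 2 + 1 / (j + 1) := by linarith
    obtain ⟨a, N, ha, ha1, haN, haq⟩ := exists_rieszParameters hq
      (show (0 : ℝ) < (1 / 2) ^ j by positivity)
    obtain ⟨c, S, B, hSc, hS0, hSB, hcS, hc0, hcM, hSi, hcq⟩ :=
      exists_rieszProduct ha ha1 hq0 j N
    -- The constant term of `S ^ 2` is exactly 1. Removing it leaves only high frequencies and
    -- lowers `qsum` from below `1 + ε` to below `ε`.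
    have hsplit : Finsupp.single 0 1 + c.erase 0 = c := by
      rw [← hc0, Finsupp.single_add_erase]
    refine ⟨(-1 : ℂ) • c.erase 0, S, hSc, hS0, ?_, ?_, ?_, (hSi.trans haN).le, ?_⟩
    · refine (integrable_exp_neg_mul_sq pi_pos).bdd_mul (c := B) hSc.aestronglyMeasurable ?_
      exact Eventually.of_forall fun x => by
        rw [Real.norm_of_nonneg (hS0 x)]
        exact hSB x
    · intro x
      rw [← hcS, trigPoly_smul]
      conv_rhs => rw [← hsplit]
      rw [trigPoly_add, trigPoly_single]
      simp [modChar_zero]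
    · intro m hm
      have h1 := Finsupp.support_smul hm
      rw [Finsupp.support_erase, Finset.mem_erase] at h1
      exact hcM m h1.2 h1.1
    · rw [qsum_smul hq0]
      have h1 : qsum (2 + 1 / ((j : ℝ) + 1)) c =
          1 + qsum (2 + 1 / ((j : ℝ) + 1)) (c.erase 0) := by
        conv_lhs => rw [← hsplit]
        rw [qsum_add_of_disjoint]
        · congr 1
          rw [qsum, Finsupp.sum_single_index (by rw [norm_zero, Real.zero_rpow hq0.ne'])]
          simp
        · rw [Finsupp.support_single _ one_ne_zero]
          simp
      simp only [norm_neg, norm_one, Real.one_rpow, one_mul]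
      linarith
  choose c S hSc hS0 hSint hcS hcM hSi hcq using key
  refine ⟨c, hcM, fun q hq => ?_, ?_⟩
  · have h2 : Tendsto (fun j : ℕ => (1 / 2 : ℝ) ^ j) atTop (𝓝 0) :=
      tendsto_pow_atTop_nhds_zero_of_lt_one (by norm_num) (by norm_num)
    have h3 : ∀ᶠ j : ℕ in atTop, 1 / ((j : ℝ) + 1) < q - 2 :=
      tendsto_one_div_add_atTop_nhds_zero_nat.eventually_lt_const (by linarith)
    refine squeeze_zero' (Eventually.of_forall fun j => qsum_nonneg _) ?_ h2
    filter_upwards [h3] with j hj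
    refine (qsum_anti (by positivity) (by linarith) ((hcq j).trans ?_)).trans (hcq j)
    exact pow_le_one₀ (by norm_num) (by norm_num)
  · have hint (j : ℕ) : ∫⁻ x, ENNReal.ofReal (S j x * rexp (-π * x ^ 2)) ≤
        ENNReal.ofReal ((1 / 2) ^ j) := by
      rw [← ofReal_integral_eq_lintegral_ofReal (hSint j)
        (Eventually.of_forall fun x => mul_nonneg (hS0 j x) (Real.exp_pos _).le)]
      exact ENNReal.ofReal_le_ofReal (hSi j)
    have hmeas (j : ℕ) : Measurable fun x => ENNReal.ofReal (S j x * rexp (-π * x ^ 2)) := by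
      have := hSc j
      exact ENNReal.measurable_ofReal.comp (by fun_prop)
    -- Summable integrals give a series convergent almost everywhere, hence `S j x → 0` without
    -- passing to a subsequence.
    have hfin : ∫⁻ x, ∑' j, ENNReal.ofReal (S j x * rexp (-π * x ^ 2)) ≠ ⊤ := by
      rw [lintegral_tsum fun j => (hmeas j).aemeasurable]
      refine ne_top_of_le_ne_top ?_ (ENNReal.tsum_le_tsum hint)
      rw [← ENNReal.ofReal_tsum_of_nonneg (fun j => by positivity)
        (summable_geometric_of_lt_one (by norm_num) (by norm_num))]
      exact ENNReal.ofReal_ne_top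
    filter_upwards [ae_lt_top (Measurable.tsum hmeas) hfin] with x hx
    have h1 := ENNReal.tendsto_atTop_zero_of_tsum_ne_top hx.ne
    have h2 := (ENNReal.tendsto_toReal ENNReal.zero_ne_top).comp h1
    have h3 : Tendsto (fun j => S j x) atTop (𝓝 0) := by
      have h4 := h2.mul_const (rexp (-π * x ^ 2))⁻¹
      simp only [ENNReal.toReal_zero, zero_mul] at h4
      refine h4.congr fun j => ?_
      simp only [Function.comp]
      rw [ENNReal.toReal_ofReal (mul_nonneg (hS0 j x) (Real.exp_pos _).le)]
      field_simp
    have h5 : Tendsto (fun j => 1 - ((S j x ^ 2 : ℝ) : ℂ)) atTop (𝓝 (1 - ((0 ^ 2 : ℝ) : ℂ))) :=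
      tendsto_const_nhds.sub ((Complex.continuous_ofReal.tendsto _).comp (h3.pow 2))
    simp only [hcS]
    simpa using h5

/-! ### Far approximation and choice of the sequence in a Hilbert space. -/

section Hilbert

variable {H : Type*} [NormedAddCommGroup H] [InnerProductSpace ℂ H]

/-- `f` is approximated by combinations of the vectors `u s` with arbitrarily far, separated
parameters `s` and arbitrarily small coefficients in `ℓ_q`. -/
def FarApprox (u : ℝ → H) (q : ℝ) (f : H) : Prop :=
  ∀ ε : ℝ, 0 < ε → ∀ R : ℝ, ∃ c : ℝ →₀ ℂ,
    (∀ s ∈ c.support, ∀ t ∈ c.support, s ≠ t → 1 ≤ |s - t|) ∧ (∀ s ∈ c.support, R ≤ |s|) ∧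
    ‖f - c.sum fun s a => a • u s‖ < ε ∧ qsum q c < ε

lemma exists_abs_le_of_mem_support (c : ℝ →₀ ℂ) : ∃ B : ℝ, ∀ s ∈ c.support, |s| ≤ B :=
  ⟨∑ s ∈ c.support, |s|, fun _ hs =>
    Finset.single_le_sum (f := fun s : ℝ => |s|) (fun _ _ => abs_nonneg _) hs⟩

lemma one_le_abs_sub_of_abs_add_one_le {s t : ℝ} (h : |s| + 1 ≤ |t|) : 1 ≤ |s - t| := by
  have := abs_sub_abs_le_abs_sub t s
  rw [abs_sub_comm]
  linarith

variable {u : ℝ → H} {q : ℝ}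

lemma FarApprox.zero : FarApprox u q 0 := fun ε hε _ =>
  ⟨0, by simp, by simp, by simpa using hε, by simpa [qsum] using hε⟩

/-- The support for `g` is chosen beyond the one for `f`, so separation survives and no coefficients
overlap. -/
lemma FarApprox.add {f g : H} (hf : FarApprox u q f) (hg : FarApprox u q g) :
    FarApprox u q (f + g) := by
  intro ε hε R
  obtain ⟨c, hc1, hc2, hc3, hc4⟩ := hf (ε / 2) (by positivity) R
  obtain ⟨B, hB⟩ := exists_abs_le_of_mem_support c
  obtain ⟨d, hd1, hd2, hd3, hd4⟩ := hg (ε / 2) (by positivity) (max R (B + 1))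
  have hcd {s t : ℝ} (hs : s ∈ c.support) (ht : t ∈ d.support) : 1 ≤ |s - t| := by
    have h1 := hB s hs
    have h2 := (le_max_right _ _).trans (hd2 t ht)
    exact one_le_abs_sub_of_abs_add_one_le (by linarith)
  have hdisj : Disjoint c.support d.support := Finset.disjoint_left.2 fun s hs hs' => by
    have := hcd hs hs'
    norm_num at this
  refine ⟨c + d, ?_, ?_, ?_, ?_⟩
  · intro s hs t ht hst
    rcases Finset.mem_union.1 (Finsupp.support_add hs) with hs | hs <;>
      rcases Finset.mem_union.1 (Finsupp.support_add ht) with ht | ht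
    · exact hc1 s hs t ht hst
    · exact hcd hs ht
    · rw [abs_sub_comm]
      exact hcd ht hs
    · exact hd1 s hs t ht hst
  · intro s hs
    rcases Finset.mem_union.1 (Finsupp.support_add hs) with hs | hs
    · exact hc2 s hs
    · exact (le_max_left _ _).trans (hd2 s hs)
  · rw [Finsupp.sum_add_index' (by simp) (fun _ _ _ => add_smul _ _ _), add_sub_add_comm]
    exact (norm_add_le _ _).trans_lt (by linarith)
  · rw [qsum_add_of_disjoint hdisj]
    linarith

lemma FarApprox.smul (hq : 0 < q) {f : H} (hf : FarApprox u q f) (b : ℂ) :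
    FarApprox u q (b • f) := by
  intro ε hε R
  set K := 1 + ‖b‖ + ‖b‖ ^ q
  have hb : 0 ≤ ‖b‖ ^ q := by positivity
  have hK : 0 < K := by positivity
  obtain ⟨c, hc1, hc2, hc3, hc4⟩ := hf (ε / K) (by positivity) R
  rw [lt_div_iff₀ hK] at hc3 hc4
  refine ⟨b • c, ?_, ?_, ?_, ?_⟩
  · exact fun s hs t ht => hc1 s (Finsupp.support_smul hs) t (Finsupp.support_smul ht)
  · exact fun s hs => hc2 s (Finsupp.support_smul hs)
  · have : (b • c).sum (fun s a => a • u s) = b • c.sum fun s a => a • u s := by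
      rw [Finsupp.sum_smul_index' (by simp), Finsupp.smul_sum]
      exact Finsupp.sum_congr fun s _ => by rw [smul_assoc]
    rw [this, ← smul_sub, norm_smul]
    nlinarith [norm_nonneg b, norm_nonneg (f - c.sum fun s a => a • u s)]
  · rw [qsum_smul hq]
    nlinarith [norm_nonneg b, qsum_nonneg (q := q) c]

/-- The coefficient bound does not depend on the vector approximated, so it survives limits:
far-approximable vectors form a closed subspace, and checking generators suffices. -/
lemma FarApprox.of_forall_exists_near {f : H}
    (h : ∀ ε : ℝ, 0 < ε → ∃ g, FarApprox u q g ∧ ‖f - g‖ < ε) : FarApprox u q f := by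
  intro ε hε R
  obtain ⟨g, hg, hfg⟩ := h (ε / 2) (by positivity)
  obtain ⟨c, hc1, hc2, hc3, hc4⟩ := hg (ε / 2) (by positivity) R
  refine ⟨c, hc1, hc2, ?_, by linarith⟩
  calc ‖f - c.sum fun s a => a • u s‖ = ‖(f - g) + (g - c.sum fun s a => a • u s)‖ := by
        rw [sub_add_sub_cancel]
    _ < ε := (norm_add_le _ _).trans_lt (by linarith)

lemma FarApprox.of_dense (hq : 0 < q) (hu : ∀ s, FarApprox u q (u s))
    (hd : (Submodule.span ℂ (Set.range u)).topologicalClosure = ⊤) (f : H) :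
    FarApprox u q f := by
  refine FarApprox.of_forall_exists_near fun ε hε => ?_
  have hf : f ∈ closure (Submodule.span ℂ (Set.range u) : Set H) := by
    rw [← Submodule.topologicalClosure_coe, hd]
    trivial
  obtain ⟨g, hg, hfg⟩ := Metric.mem_closure_iff.1 hf ε hε
  refine ⟨g, ?_, by rwa [← dist_eq_norm]⟩
  clear hfg
  induction hg using Submodule.span_induction with
  | mem x hx =>
    obtain ⟨s, rfl⟩ := hx
    exact hu s
  | zero => exact FarApprox.zero
  | add x y _ _ hx hy => exact hx.add hy
  | smul a x _ hx => exact hx.smul hq a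

open TopologicalSpace in
/-- A separated sequence of parameters for which all approximations with `ℓ_q` control, `q > 2`, are
available. -/
theorem exists_separated_isCompleteWithEstimate [SeparableSpace H]
    (h : ∀ q : ℝ, 2 < q → ∀ f : H, FarApprox u q f) :
    ∃ Λ : ℕ → ℝ, IsUniformlyDiscrete Λ ∧
      ∀ q : ℝ, 2 < q → IsCompleteWithEstimate (fun n => u (Λ n)) q := by
  have hη (j : ℕ) : (0 : ℝ) < 1 / (j + 1) := by positivity
  -- Through `Nat.unpair` every dense vector recurs in infinitely many blocks, with errors tending
  -- to 0 and exponents to 2.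
  choose F hF1 hF2 hF3 hF4 using fun j : ℕ =>
    h (2 + 1 / (j + 1)) (by linarith [hη j]) (denseSeq H (Nat.unpair j).1) (1 / (j + 1)) (hη j)
  choose B hB using exists_abs_le_of_mem_support
  let R : ℕ → ℝ := fun j => Nat.rec 0 (fun j r => max r (B (F j r)) + 2) j
  have hR (j : ℕ) : R (j + 1) = max (R j) (B (F j (R j))) + 2 := rfl
  have hRj (j : ℕ) : R j + 2 ≤ R (j + 1) := by
    rw [hR]
    linarith [le_max_left (R j) (B (F j (R j)))]
  have hRmono : Monotone R := monotone_nat_of_le_succ fun j => by linarith [hRj j]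
  have hR0 (j : ℕ) : 0 ≤ R j := hRmono (Nat.zero_le j)
  -- The extra point only makes the union infinite, hence indexable by `ℕ`. The `+ 2` in `R` leaves
  -- distance 1 from it to both neighbouring blocks.
  let S : ℕ → Set ℝ := fun j => insert (R (j + 1) - 1) ((F j (R j)).support : Set ℝ)
  have hp (j : ℕ) : |R (j + 1) - 1| = R (j + 1) - 1 :=
    abs_of_nonneg (by linarith [hRj j, hR0 j])
  have hsupp {j : ℕ} {s : ℝ} (hs : s ∈ (F j (R j)).support) : |s| + 1 ≤ R (j + 1) - 1 := by
    rw [hR]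
    linarith [hB _ s hs, le_max_right (R j) (B (F j (R j)))]
  have hSle {j : ℕ} {s : ℝ} (hs : s ∈ S j) : |s| ≤ R (j + 1) - 1 := by
    rcases hs with rfl | hs
    · exact (hp j).le
    · linarith [hsupp hs]
  have hleS {j : ℕ} {s : ℝ} (hs : s ∈ S j) : R j ≤ |s| := by
    rcases hs with rfl | hs
    · rw [hp]
      linarith [hRj j]
    · exact hF2 _ _ s hs
  have hsep : ∀ s ∈ ⋃ j, S j, ∀ t ∈ ⋃ j, S j, s ≠ t → 1 ≤ |s - t| := by
    intro s hs t ht hst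
    obtain ⟨i, hs⟩ := Set.mem_iUnion.1 hs
    obtain ⟨j, ht⟩ := Set.mem_iUnion.1 ht
    rcases lt_trichotomy i j with hij | rfl | hij
    · have := hRmono hij
      refine one_le_abs_sub_of_abs_add_one_le ?_
      linarith [hSle hs, hleS ht, show R (i + 1) ≤ R j from this]
    · rcases hs with rfl | hs <;> rcases ht with rfl | ht
      · exact absurd rfl hst
      · rw [abs_sub_comm]
        exact one_le_abs_sub_of_abs_add_one_le (by rw [hp]; exact hsupp ht)
      · exact one_le_abs_sub_of_abs_add_one_le (by rw [hp]; exact hsupp hs)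
      · exact hF1 _ _ s hs t ht hst
    · have := hRmono hij
      rw [abs_sub_comm]
      refine one_le_abs_sub_of_abs_add_one_le ?_
      linarith [hSle ht, hleS hs, show R (j + 1) ≤ R i from this]
  have hcount : (⋃ j, S j).Countable :=
    Set.countable_iUnion fun j => ((F j (R j)).support.countable_toSet).insert _
  have hinf : (⋃ j, S j).Infinite := by
    refine Set.infinite_of_injective_forall_mem (f := fun j : ℕ => R (j + 1) - 1) ?_
      fun j => Set.mem_iUnion.2 ⟨j, Set.mem_insert _ _⟩
    refine StrictMono.injective (strictMono_nat_of_lt_succ fun j => ?_)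
    linarith [hRj (j + 1)]
  have : Countable (⋃ j, S j) := hcount
  have : Infinite (⋃ j, S j) := hinf.to_subtype
  obtain ⟨e⟩ : Nonempty (ℕ ≃ ⋃ j, S j) := nonempty_equiv_of_countable
  have hinj : Function.Injective fun n => (e n : ℝ) := Subtype.val_injective.comp e.injective
  refine ⟨fun n => e n, ⟨1, one_pos, fun m n hmn =>
    hsep _ (e m).2 _ (e n).2 (hinj.ne hmn)⟩, fun q hq => ⟨1, fun f ε hε => ?_⟩⟩
  by_cases hf : f = 0
  · have hq0 : q ≠ 0 := by linarith
    exact ⟨0, by simpa [hf] using hε, by simp [hf, hq0]⟩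
  have hf' : 0 < ‖f‖ := norm_pos_iff.2 hf
  obtain ⟨k, hk⟩ : ∃ k, ‖f - denseSeq H k‖ < ε / 2 := by
    obtain ⟨_, ⟨k, rfl⟩, hk⟩ := Metric.mem_closure_iff.1 (denseRange_denseSeq H f) (ε / 2)
      (by positivity)
    exact ⟨k, by rwa [← dist_eq_norm]⟩
  have hlim := tendsto_one_div_add_atTop_nhds_zero_nat (𝕜 := ℝ)
  have hj : Tendsto (fun l => Nat.pair k l) atTop atTop :=
    tendsto_atTop_mono (fun l => Nat.right_le_pair k l) tendsto_id
  have hlim' := hlim.comp hj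
  -- The bounds serve, in turn, the error, the passage to exponent `q`, the constant `C = 1` (hence
  -- `f ≠ 0`), and coefficients of modulus at most one.
  obtain ⟨l, hl1, hl2, hl3, hl4⟩ := ((hlim'.eventually_lt_const (show 0 < ε / 2 by positivity)).and
    ((hlim'.eventually_lt_const (show 0 < q - 2 by linarith)).and
    ((hlim'.eventually_lt_const (show 0 < ‖f‖ ^ q by positivity)).and
    (hlim'.eventually_lt_const one_pos)))).exists
  simp only [Function.comp] at hl1 hl2 hl3 hl4
  set j := Nat.pair k l with hjdef
  have hjk : (Nat.unpair j).1 = k := by simp [hjdef]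
  have hF3' := hF3 j (R j)
  have hF4' := hF4 j (R j)
  rw [hjk] at hF3'
  set c := F j (R j)
  have hbij : Set.BijOn (fun n => (e n : ℝ)) ((fun n => (e n : ℝ)) ⁻¹' (c.support : Set ℝ))
      (c.support : Set ℝ) := by
    refine ⟨fun n hn => hn, hinj.injOn, fun s hs => ?_⟩
    have hs' : s ∈ ⋃ j, S j := Set.mem_iUnion.2 ⟨j, Set.mem_insert_of_mem _ hs⟩
    have he : (e (e.symm ⟨s, hs'⟩) : ℝ) = s := by simp
    exact ⟨e.symm ⟨s, hs'⟩, by simpa [he] using hs, he⟩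
  refine ⟨c.comapDomain (fun n => (e n : ℝ)) hbij.injOn, ?_, ?_⟩
  · have := Finsupp.sum_comapDomain (fun n => (e n : ℝ)) c (fun s a => a • u s) hbij
    simp only [Function.comp_def] at this
    rw [this]
    calc ‖f - c.sum fun s a => a • u s‖
        = ‖(f - denseSeq H k) + (denseSeq H k - c.sum fun s a => a • u s)‖ := by
          rw [sub_add_sub_cancel]
      _ < ε := (norm_add_le _ _).trans_lt (by linarith)
  · have := Finsupp.sum_comapDomain (fun n => (e n : ℝ)) c (fun _ a => ‖a‖ ^ q) hbij
    simp only [Function.comp_def] at this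
    rw [this, one_mul]
    have h1 : qsum q c ≤ ‖f‖ ^ q :=
      (qsum_anti (p := 2 + 1 / ((j : ℝ) + 1)) (by linarith [hη j]) (by linarith)
        (by linarith)).trans (by linarith)
    refine (Real.rpow_le_rpow (qsum_nonneg c) h1 (by positivity)).trans (le_of_eq ?_)
    rw [← Real.rpow_mul hf'.le, mul_one_div_cancel (by linarith), Real.rpow_one]

/-- Bessel inequality from the Schur test for the Gram matrix. -/
lemma sum_norm_inner_sq_le_of_gram {ι : Type*} {x : ι → H} {K : ℝ} (hK0 : 0 ≤ K) (s : Finset ι)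
    (hK : ∀ n ∈ s, ∑ m ∈ s, ‖inner ℂ (x n) (x m)‖ ≤ K) (v : H) :
    ∑ n ∈ s, ‖inner ℂ (x n) v‖ ^ 2 ≤ K * ‖v‖ ^ 2 := by
  set T := ∑ n ∈ s, ‖inner ℂ (x n) v‖ ^ 2 with hT
  -- Duality: `T = ⟨w, v⟩ ≤ ‖w‖ ‖v‖`, while the row sums give `‖w‖ ^ 2 ≤ K * T`.
  set w := ∑ n ∈ s, inner ℂ (x n) v • x n with hw
  have hT0 : 0 ≤ T := Finset.sum_nonneg fun _ _ => by positivity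
  have h1 : inner ℂ w v = (T : ℂ) := by
    rw [hw, sum_inner, hT]
    push_cast
    refine Finset.sum_congr rfl fun n _ => ?_
    rw [inner_smul_left, RCLike.conj_mul]
    rfl
  have h2 : ‖w‖ ^ 2 ≤ K * T := by
    have h3 : ‖w‖ ^ 2 = ‖inner ℂ w w‖ := by
      rw [inner_self_eq_norm_sq_to_K, norm_pow]
      simp
    have h4 : ‖inner ℂ w w‖ ≤ ∑ n ∈ s, ∑ m ∈ s,
        ‖inner ℂ (x n) v‖ * ‖inner ℂ (x m) v‖ * ‖inner ℂ (x n) (x m)‖ := by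
      rw [hw, sum_inner]
      refine (norm_sum_le _ _).trans (Finset.sum_le_sum fun n _ => ?_)
      rw [inner_sum]
      refine (norm_sum_le _ _).trans (Finset.sum_le_sum fun m _ => le_of_eq ?_)
      rw [inner_smul_left, inner_smul_right, norm_mul, norm_mul, RCLike.norm_conj]
      ring
    have h5 : ∑ n ∈ s, ∑ m ∈ s,
        ‖inner ℂ (x n) v‖ * ‖inner ℂ (x m) v‖ * ‖inner ℂ (x n) (x m)‖ ≤
        ∑ n ∈ s, ∑ m ∈ s, (‖inner ℂ (x n) v‖ ^ 2 / 2 * ‖inner ℂ (x n) (x m)‖ +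
          ‖inner ℂ (x m) v‖ ^ 2 / 2 * ‖inner ℂ (x m) (x n)‖) := by
      refine Finset.sum_le_sum fun n _ => Finset.sum_le_sum fun m _ => ?_
      rw [norm_inner_symm (x m) (x n), ← add_mul]
      refine mul_le_mul_of_nonneg_right ?_ (norm_nonneg _)
      linarith [two_mul_le_add_sq ‖inner ℂ (x n) v‖ ‖inner ℂ (x m) v‖]
    have h6 : ∑ n ∈ s, ∑ m ∈ s, ‖inner ℂ (x n) v‖ ^ 2 / 2 * ‖inner ℂ (x n) (x m)‖ ≤
        K * T / 2 := by
      rw [hT, Finset.mul_sum, Finset.sum_div]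
      refine Finset.sum_le_sum fun n hn => ?_
      rw [← Finset.mul_sum]
      have := mul_le_mul_of_nonneg_left (hK n hn)
        (show 0 ≤ ‖inner ℂ (x n) v‖ ^ 2 / 2 by positivity)
      linarith
    simp only [Finset.sum_add_distrib] at h5
    rw [Finset.sum_comm (f := fun n m => ‖inner ℂ (x m) v‖ ^ 2 / 2 * ‖inner ℂ (x m) (x n)‖)] at h5
    linarith
  have h7 : T ≤ ‖w‖ * ‖v‖ := by
    have := norm_inner_le_norm (𝕜 := ℂ) w v
    rwa [h1, Complex.norm_real, Real.norm_of_nonneg hT0] at this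
  rcases hT0.eq_or_lt with h0 | h0
  · rw [← h0]
    positivity
  · have h8 : T ^ 2 ≤ K * T * ‖v‖ ^ 2 := by
      calc T ^ 2 ≤ (‖w‖ * ‖v‖) ^ 2 := pow_le_pow_left₀ hT0 h7 2
        _ = ‖w‖ ^ 2 * ‖v‖ ^ 2 := by ring
        _ ≤ _ := by gcongr
    nlinarith

end Hilbert

/-! ### Multipliers, modulations and the Fourier transform on `L²(ℝ)`. -/

/-- The Hilbert space `L²(ℝ)`. -/
abbrev L2R : Type := Lp ℂ 2 (volume : Measure ℝ)

/-- Multiplication by a bounded function on `L²(ℝ)`. -/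
def mulL2 {m : ℝ → ℂ} (hm : MemLp m ⊤ volume) : L2R →L[ℂ] L2R :=
  (ContinuousLinearMap.mul ℂ ℂ).holderL volume ⊤ 2 2 (hm.toLp m)

lemma coeFn_mulL2 {m : ℝ → ℂ} (hm : MemLp m ⊤ volume) (f : L2R) :
    mulL2 hm f =ᵐ[volume] fun x => m x * f x := by
  filter_upwards [(ContinuousLinearMap.mul ℂ ℂ).coeFn_holder (r := 2) (hm.toLp m) f,
    hm.coeFn_toLp] with x h1 h2
  refine h1.trans ?_
  simp [h2]

lemma norm_mulL2_le {m : ℝ → ℂ} (hm : MemLp m ⊤ volume) (h : ∀ x, ‖m x‖ ≤ 1) (f : L2R) :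
    ‖mulL2 hm f‖ ≤ ‖f‖ := by
  refine Lp.norm_le_norm_of_ae_le ?_
  filter_upwards [coeFn_mulL2 hm f] with x hx
  rw [hx, norm_mul]
  exact mul_le_of_le_one_left (norm_nonneg _) (h x)

lemma memLp_modChar (a : ℝ) : MemLp (modChar a) ⊤ volume :=
  memLp_top_of_bound (continuous_modChar a).aestronglyMeasurable 1
    (Eventually.of_forall fun x => (norm_modChar a x).le)

/-- Multiplication by the character `x ↦ exp (-2πi a x)`. -/
def modL2 (a : ℝ) : L2R →L[ℂ] L2R := mulL2 (memLp_modChar a)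

lemma coeFn_modL2 (a : ℝ) (f : L2R) : modL2 a f =ᵐ[volume] fun x => modChar a x * f x :=
  coeFn_mulL2 _ f

lemma modL2_add (a b : ℝ) (f : L2R) : modL2 (a + b) f = modL2 a (modL2 b f) := by
  refine Lp.ext ?_
  filter_upwards [coeFn_modL2 (a + b) f, coeFn_modL2 a (modL2 b f), coeFn_modL2 b f]
    with x h1 h2 h3
  rw [h1, h2, h3, modChar_add, mul_assoc]

lemma conj_modChar (a x : ℝ) : conj (modChar a x) = modChar (-a) x := by
  rw [modChar, modChar, neg_mul, neg_neg, ← Circle.coe_inv_eq_conj, ← AddChar.map_neg_eq_inv,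
    neg_neg]

lemma translateL2_toLp (a : ℝ) (f : 𝓢(ℝ, ℂ)) :
    translateL2 a (f.toLp 2) = (f.compSubConstCLM ℂ a).toLp 2 := by
  refine Lp.ext ?_
  have h := Lp.coeFn_compMeasurePreserving (f.toLp 2 (μ := volume))
    (measurePreserving_sub_right volume a)
  have h2 := (measurePreserving_sub_right volume a).quasiMeasurePreserving.ae_eq_comp
    (f.coeFn_toLp 2 volume)
  filter_upwards [h, h2, (f.compSubConstCLM ℂ a).coeFn_toLp 2 volume] with x h1 h2 h3
  rw [h3]
  exact h1.trans h2

/-- The Fourier transform turns translations into modulations. -/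
lemma fourier_translateL2 (a : ℝ) (g : L2R) : 𝓕 (translateL2 a g) = modL2 a (𝓕 g) := by
  refine DenseRange.induction_on (p := fun g : L2R => 𝓕 (translateL2 a g) = modL2 a (𝓕 g))
    (SchwartzMap.denseRange_toLpCLM (p := 2) ENNReal.ofNat_ne_top) g ?_ ?_
  · refine isClosed_eq ?_ ?_
    · exact (Lp.fourierTransformₗᵢ ℝ ℂ).continuous.comp
        (Lp.isometry_compMeasurePreserving _).continuous
    · exact (modL2 a).continuous.comp (Lp.fourierTransformₗᵢ ℝ ℂ).continuous
  · intro f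
    rw [SchwartzMap.toLpCLM_apply, translateL2_toLp, SchwartzMap.toLp_fourier_eq,
      SchwartzMap.toLp_fourier_eq]
    refine Lp.ext ?_
    filter_upwards [(𝓕 (f.compSubConstCLM ℂ a)).coeFn_toLp 2 volume,
      (𝓕 f).coeFn_toLp 2 volume, coeFn_modL2 a ((𝓕 f).toLp 2)] with x h1 h2 h3
    rw [h1, h3, h2, SchwartzMap.fourier_coe, SchwartzMap.fourier_coe]
    have := congrFun (VectorFourier.fourierIntegral_comp_add_right Real.fourierChar volume
      (innerₗ ℝ) f (-a)) x
    have e : (f.compSubConstCLM ℂ a : ℝ → ℂ) = f ∘ fun v => v + -a := by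
      ext v
      simp [sub_eq_add_neg]
    rw [e]
    refine this.trans ?_
    have hx : innerₗ ℝ (-a) x = -(a * x) := by simp [mul_comm]
    rw [hx, Circle.smul_def, smul_eq_mul]
    rfl

/-! ### Bessel inequality for modulated Gaussians. -/

lemma memLp_gaussian (N : ℝ) :
    MemLp (fun x : ℝ => ((rexp (-π * (x - N) ^ 2) : ℝ) : ℂ)) 2 volume := by
  rw [memLp_two_iff_integrable_sq_norm (by fun_prop)]
  have := (integrable_exp_neg_mul_sq (b := 2 * π) (by positivity)).comp_sub_right N
  refine this.congr (Eventually.of_forall fun x => ?_)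
  simp only [Complex.norm_real, Real.norm_of_nonneg (Real.exp_pos _).le]
  rw [← Real.exp_nat_mul]
  push_cast
  ring_nf

/-- The Gaussian `exp (-π (x - N)²)` as an element of `L²(ℝ)`. -/
def gaussL2 (N : ℝ) : L2R := (memLp_gaussian N).toLp _

lemma coeFn_gaussL2 (N : ℝ) :
    gaussL2 N =ᵐ[volume] fun x : ℝ => ((rexp (-π * (x - N) ^ 2) : ℝ) : ℂ) :=
  (memLp_gaussian N).coeFn_toLp

/-- The inner product is the Fourier transform of a squared Gaussian at `b - a`; the centre `N`
contributes only a phase, so the bound is uniform in `N`. -/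
lemma norm_inner_modL2_gaussL2_le (a b N : ℝ) :
    ‖inner ℂ (modL2 a (gaussL2 N)) (modL2 b (gaussL2 N))‖ ≤ rexp (-(π / 2) * (b - a) ^ 2) := by
  have h1 : inner ℂ (modL2 a (gaussL2 N)) (modL2 b (gaussL2 N)) =
      ∫ x : ℝ, Complex.exp ((-(2 * π) : ℝ) * x ^ 2 +
        ((4 * π * N : ℝ) - (2 * π * (b - a) : ℝ) * Complex.I) * x + (-(2 * π * N ^ 2) : ℝ)) := by
    rw [L2.inner_def]
    refine integral_congr_ae ?_
    filter_upwards [coeFn_modL2 a (gaussL2 N), coeFn_modL2 b (gaussL2 N), coeFn_gaussL2 N]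
      with x h1 h2 h3
    rw [h1, h2, h3]
    simp only [RCLike.inner_apply, map_mul, conj_modChar, Complex.conj_ofReal]
    simp only [modChar, Real.fourierChar_apply, Complex.ofReal_exp, ← Complex.exp_add]
    congr 1
    push_cast
    ring
  rw [h1, integral_cexp_quadratic (by simp [pi_pos]), norm_mul]
  have h2 : ‖((π : ℂ) / -(-(2 * π) : ℝ)) ^ (1 / 2 : ℂ)‖ ≤ 1 := by
    have e : (π : ℂ) / -(-(2 * π) : ℝ) = ((1 / 2 : ℝ) : ℂ) := by
      have : (π : ℂ) ≠ 0 := by exact_mod_cast pi_ne_zero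
      push_cast
      field_simp
    rw [e, Complex.norm_cpow_eq_rpow_re_of_pos (by norm_num)]
    exact Real.rpow_le_one (by norm_num) (by norm_num) (by norm_num)
  refine (mul_le_of_le_one_left (norm_nonneg _) h2).trans (le_of_eq ?_)
  rw [Complex.norm_exp]
  congr 1
  have e : ((-(2 * π * N ^ 2) : ℝ) : ℂ) -
      ((4 * π * N : ℝ) - (2 * π * (b - a) : ℝ) * Complex.I) ^ 2 / (4 * (-(2 * π) : ℝ)) =
        ((-(π / 2) * (b - a) ^ 2 : ℝ) : ℂ) +
        (-(2 * π * N * (b - a)) : ℝ) * Complex.I := by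
    have : (π : ℂ) ≠ 0 := by exact_mod_cast pi_ne_zero
    push_cast
    field_simp
    ring_nf
    simp only [Complex.I_sq]
    ring
  rw [e]
  simp only [Complex.add_re, Complex.ofReal_re, Complex.mul_re, Complex.I_re, Complex.I_im,
    Complex.ofReal_im]
  ring

lemma summable_int_gaussian {b : ℝ} (hb : 0 < b) : Summable fun k : ℤ => rexp (-b * k ^ 2) := by
  have h : Summable fun k : ℕ => rexp (-b * (k : ℝ) ^ 2) := by
    refine Summable.of_nonneg_of_le (fun _ => (Real.exp_pos _).le) (fun k => ?_)
      (Real.summable_exp_nat_mul_of_ge (c := -b) (by linarith) (f := fun k => (k : ℝ) ^ 2)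
        fun k => ?_)
    · exact le_rfl
    · rcases Nat.eq_zero_or_pos k with rfl | hk
      · simp
      · have : (1 : ℝ) ≤ k := by exact_mod_cast hk
        nlinarith
  refine Summable.of_nat_of_neg ?_ ?_
  · simpa using h
  · simpa using h

/-- Sums of a Gaussian over uniformly discrete sets are bounded uniformly under shifts. -/
lemma IsUniformlyDiscrete.exists_sum_gaussian_le {ι : Type*} {Λ : ι → ℝ}
    (h : IsUniformlyDiscrete Λ) {b : ℝ} (hb : 0 < b) :
    ∃ K : ℝ, 0 ≤ K ∧ ∀ (s : Finset ι) (t : ℝ), ∑ n ∈ s, rexp (-b * (Λ n - t) ^ 2) ≤ K := by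
  obtain ⟨δ, hδ, hΛ⟩ := h
  have hsum := summable_int_gaussian (b := b * δ ^ 2 / 2) (by positivity)
  refine ⟨rexp (b * δ ^ 2) * ∑' k : ℤ, rexp (-(b * δ ^ 2 / 2) * k ^ 2),
    mul_nonneg (Real.exp_pos _).le (tsum_nonneg fun _ => (Real.exp_pos _).le), fun s t => ?_⟩
  -- Points at least `δ` apart fall into different cells of length `δ`, so the sum is compared with
  -- one over `ℤ`; rounding costs `φ² ≤ 2z² + 2`.
  let φ : ι → ℤ := fun n => ⌊(Λ n - t) / δ⌋
  have hφ : Function.Injective φ := by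
    intro m n hmn
    by_contra hne
    have h1 := Int.abs_sub_lt_one_of_floor_eq_floor hmn
    rw [← sub_div, abs_div, abs_of_pos hδ, div_lt_one hδ] at h1
    have := hΛ m n hne
    rw [sub_sub_sub_cancel_right] at h1
    linarith
  have hterm (n : ι) : rexp (-b * (Λ n - t) ^ 2) ≤
      rexp (b * δ ^ 2) * rexp (-(b * δ ^ 2 / 2) * (φ n : ℝ) ^ 2) := by
    rw [← Real.exp_add, Real.exp_le_exp]
    set z := (Λ n - t) / δ with hz
    have h1 : Λ n - t = δ * z := by rw [hz]; field_simp
    have h2 : (φ n : ℝ) ≤ z := Int.floor_le z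
    have h3 : z < φ n + 1 := Int.lt_floor_add_one z
    have h4 : (φ n : ℝ) ^ 2 ≤ 2 * z ^ 2 + 2 := by
      nlinarith [sq_nonneg (2 * z - φ n), sq_nonneg (z + (z - φ n))]
    rw [h1]
    nlinarith [mul_le_mul_of_nonneg_left h4 (show 0 ≤ b * δ ^ 2 / 2 by positivity)]
  calc ∑ n ∈ s, rexp (-b * (Λ n - t) ^ 2)
      ≤ ∑ n ∈ s, rexp (b * δ ^ 2) * rexp (-(b * δ ^ 2 / 2) * (φ n : ℝ) ^ 2) :=
        Finset.sum_le_sum fun n _ => hterm n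
    _ = rexp (b * δ ^ 2) * ∑ k ∈ s.map ⟨φ, hφ⟩, rexp (-(b * δ ^ 2 / 2) * (k : ℝ) ^ 2) := by
        rw [Finset.sum_map, Finset.mul_sum]
        rfl
    _ ≤ _ := by
        refine mul_le_mul_of_nonneg_left ?_ (Real.exp_pos _).le
        exact hsum.sum_le_tsum _ fun _ _ => (Real.exp_pos _).le

/-- Bessel inequality for modulated Gaussians, uniformly in the centre of the Gaussian. -/
lemma IsUniformlyDiscrete.exists_bessel_gaussL2 {ι : Type*} {Λ : ι → ℝ}
    (h : IsUniformlyDiscrete Λ) : ∃ K : ℝ, 0 ≤ K ∧ ∀ (N : ℝ) (v : L2R) (s : Finset ι),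
      ∑ n ∈ s, ‖inner ℂ (modL2 (Λ n) (gaussL2 N)) v‖ ^ 2 ≤ K * ‖v‖ ^ 2 := by
  obtain ⟨K, hK0, hK⟩ := h.exists_sum_gaussian_le (b := π / 2) (by positivity)
  refine ⟨K, hK0, fun N v s => sum_norm_inner_sq_le_of_gram hK0 s (fun n _ => ?_) v⟩
  exact (Finset.sum_le_sum fun m _ => norm_inner_modL2_gaussL2_le _ _ N).trans (hK s (Λ n))

/-! ### Completeness of modulations and the weight. -/

/-- An integrable function with vanishing Fourier transform vanishes almost everywhere. -/
lemma ae_eq_zero_of_fourier_eq_zero {F : ℝ → ℂ} (hF : Integrable F)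
    (h : ∀ a : ℝ, ∫ x, modChar a x * F x = 0) : ∀ᵐ x, F x = 0 := by
  have h0 : 𝓕 F = 0 := by
    ext a
    rw [Real.fourier_eq, Pi.zero_apply, ← h a]
    refine integral_congr_ae (Eventually.of_forall fun x => ?_)
    simp [Circle.smul_def, modChar]
  refine ae_eq_zero_of_integral_contDiff_smul_eq_zero hF.locallyIntegrable fun φ hφ hφc => ?_
  have hc : HasCompactSupport (Complex.ofRealCLM ∘ φ) := hφc.comp_left rfl
  have hd : ContDiff ℝ ((⊤ : ℕ∞) : WithTop ℕ∞) (Complex.ofRealCLM ∘ φ) := by fun_prop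
  set ψ : 𝓢(ℝ, ℂ) := hc.toSchwartzMap hd with hψ
  -- The multiplication formula, applied to the inverse transform of `ψ`, shows that `F` annihilates
  -- every test function.
  have h1 := VectorFourier.integral_fourierIntegral_smul_eq_flip (L := innerₗ ℝ)
    Real.continuous_fourierChar continuous_inner hF
    ((𝓕⁻ ψ).integrable (μ := volume))
  have h2 : ∫ ξ, (𝓕 F ξ) • (𝓕⁻ ψ) ξ = 
      ∫ x, F x • 𝓕 ((𝓕⁻ ψ : 𝓢(ℝ, ℂ)) : ℝ → ℂ) x := by
    rw [flip_innerₗ] at h1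
    exact h1
  rw [h0] at h2
  simp only [Pi.zero_apply, zero_smul, integral_zero] at h2
  have h3 : 𝓕 ((𝓕⁻ ψ : 𝓢(ℝ, ℂ)) : ℝ → ℂ) = ψ := by
    rw [← SchwartzMap.fourier_coe, FourierTransform.fourier_fourierInv_eq]
  rw [h3] at h2
  rw [h2]
  refine integral_congr_ae (Eventually.of_forall fun x => ?_)
  simp [hψ, mul_comm]

/-- Modulations of an almost everywhere nonvanishing function span `L²(ℝ)`. -/
lemma span_modL2_topologicalClosure {g : L2R} (hg : ∀ᵐ x, g x ≠ 0) :
    (Submodule.span ℂ (Set.range fun a => modL2 a g)).topologicalClosure = ⊤ := by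
  rw [Submodule.topologicalClosure_eq_top_iff, Submodule.eq_bot_iff]
  intro v hv
  rw [Submodule.mem_orthogonal] at hv
  have h1 (a : ℝ) : ∫ x, modChar a x * (conj (g x) * v x) = 0 := by
    rw [← hv _ (Submodule.subset_span ⟨-a, rfl⟩), L2.inner_def]
    refine integral_congr_ae ?_
    filter_upwards [coeFn_modL2 (-a) g] with x hx
    simp only [hx, RCLike.inner_apply, map_mul, conj_modChar, neg_neg]
    ring
  have hint : Integrable fun x => conj (g x) * v x := by
    refine (L2.integrable_inner g v).congr (Eventually.of_forall fun x => ?_)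
    simp only [RCLike.inner_apply]
    ring
  rw [Lp.eq_zero_iff_ae_eq_zero]
  filter_upwards [ae_eq_zero_of_fourier_eq_zero hint h1, hg] with x hx hgx
  simpa [hgx] using hx

lemma coeFn_sum_smul_modL2 (c : ℤ →₀ ℂ) (g : L2R) :
    (c.sum fun n a => a • modL2 n g : L2R) =ᵐ[volume] fun x => trigPoly c x * g x := by
  induction c using Finsupp.induction_linear with
  | zero =>
    exact Eventually.of_forall fun x => by simp [trigPoly]
  | add c d hc hd =>
    rw [Finsupp.sum_add_index' (by simp) (fun _ _ _ => add_smul _ _ _)]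
    filter_upwards [hc, hd, Lp.coeFn_add (c.sum fun n a => a • modL2 n g)
      (d.sum fun n a => a • modL2 n g)] with x h1 h2 h3
    rw [h3, Pi.add_apply, h1, h2, trigPoly_add, add_mul]
  | single n a =>
    rw [Finsupp.sum_single_index (by simp)]
    filter_upwards [Lp.coeFn_smul a (modL2 n g), coeFn_modL2 n g] with x h1 h2
    rw [h1, Pi.smul_apply, h2, trigPoly_single, smul_eq_mul, mul_assoc]

/-- Dominated convergence in `L²(ℝ)` to zero. -/
lemma tendsto_norm_zero_of_dominated {F : ℕ → L2R} {G : L2R}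
    (hb : ∀ n, ∀ᵐ x, ‖F n x‖ ≤ ‖G x‖)
    (hlim : ∀ᵐ x, Tendsto (fun n => F n x) atTop (𝓝 0)) :
    Tendsto (fun n => ‖F n‖) atTop (𝓝 0) := by
  have hsq (f : L2R) : ‖f‖ ^ 2 = ∫ x, ‖f x‖ ^ 2 := by
    have h : ((‖f‖ ^ 2 : ℝ) : ℂ) = ((∫ x, ‖f x‖ ^ 2 : ℝ) : ℂ) := by
      rw [← integral_complex_ofReal]
      have h1 := inner_self_eq_norm_sq_to_K (𝕜 := ℂ) f
      rw [L2.inner_def] at h1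
      simp only [inner_self_eq_norm_sq_to_K] at h1
      simpa using h1.symm
    exact_mod_cast h
  have h1 : Tendsto (fun n => ∫ x, ‖F n x‖ ^ 2) atTop (𝓝 (∫ _ : ℝ, (0 : ℝ))) := by
    refine tendsto_integral_of_dominated_convergence (fun x => ‖G x‖ ^ 2) (fun n => ?_) ?_ ?_ ?_
    · exact ((Lp.aestronglyMeasurable (F n)).norm).pow 2
    · exact (memLp_two_iff_integrable_sq_norm (Lp.aestronglyMeasurable G)).1 (Lp.memLp G)
    · intro n
      filter_upwards [hb n] with x hx
      rw [Real.norm_of_nonneg (by positivity)]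
      gcongr
    · filter_upwards [hlim] with x hx
      simpa using hx.norm.pow 2
  rw [integral_zero] at h1
  have h2 := h1.sqrt
  rw [Real.sqrt_zero] at h2
  refine h2.congr fun n => ?_
  rw [← hsq, Real.sqrt_sq (norm_nonneg _)]

lemma norm_modL2_le (a : ℝ) (f : L2R) : ‖modL2 a f‖ ≤ ‖f‖ :=
  norm_mulL2_le _ (fun x => (norm_modChar a x).le) f

/-- If the trigonometric polynomials `P_j` tend to one in the weighted space, then modulations of
the weight have far approximations. -/
lemma farApprox_modL2 {g : L2R} {c : ℕ → ℤ →₀ ℂ} {q : ℝ}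
    (hc : ∀ j, ∀ m ∈ (c j).support, (j : ℤ) ≤ |m|)
    (hcq : Tendsto (fun j => qsum q (c j)) atTop (𝓝 0))
    (hg : Tendsto (fun j => ‖g - (c j).sum fun n a => a • modL2 n g‖) atTop (𝓝 0)) (s : ℝ) :
    FarApprox (fun a => modL2 a g) q (modL2 s g) := by
  intro ε hε R
  obtain ⟨j, hj1, hj2, hj3⟩ := ((hcq.eventually_lt_const hε).and
    ((hg.eventually_lt_const hε).and (eventually_ge_atTop ⌈R + |s|⌉₊))).exists
  have hj3 : R + |s| ≤ j := Nat.ceil_le.1 hj3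
  -- Modulating by `s` moves the frequencies to `s + n`: integer gaps keep them separated, and `|s +
  -- n| ≥ j - |s| ≥ R`.
  let φ : ℤ ↪ ℝ := ⟨fun n => s + n, fun m n h => by simpa using h⟩
  refine ⟨(c j).embDomain φ, ?_, ?_, ?_, ?_⟩
  · intro x hx y hy hxy
    rw [Finsupp.support_embDomain, Finset.mem_map] at hx hy
    obtain ⟨m, hm, rfl⟩ := hx
    obtain ⟨n, hn, rfl⟩ := hy
    have hmn : m ≠ n := fun h => hxy (by rw [h])
    have h1 : (1 : ℤ) ≤ |m - n| := Int.one_le_abs (sub_ne_zero.2 hmn)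
    have h2 : φ m - φ n = ((m - n : ℤ) : ℝ) := by
      change (s + m) - (s + n) = _
      push_cast
      ring
    rw [h2]
    exact_mod_cast h1
  · intro x hx
    rw [Finsupp.support_embDomain, Finset.mem_map] at hx
    obtain ⟨m, hm, rfl⟩ := hx
    have h1 : (j : ℝ) ≤ |(m : ℝ)| := by exact_mod_cast hc j m hm
    have h2 : |(m : ℝ)| ≤ |s + m| + |s| := by
      have := abs_sub_abs_le_abs_sub (m : ℝ) (-s)
      rw [abs_neg, sub_neg_eq_add, add_comm (m : ℝ) s] at this
      linarith
    change R ≤ |s + m|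
    linarith
  · rw [Finsupp.sum_embDomain]
    have h1 : ((c j).sum fun n a => a • modL2 (φ n) g) =
        modL2 s ((c j).sum fun n a => a • modL2 n g) := by
      rw [map_finsuppSum]
      refine Finsupp.sum_congr fun n _ => ?_
      rw [map_smul, ← modL2_add]
      rfl
    rw [h1, ← map_sub]
    exact (norm_modL2_le _ _).trans_lt hj2
  · rwa [qsum, Finsupp.sum_embDomain]

/-- There is a weighted Gaussian whose modulations give far approximations of all vectors. -/
lemma exists_weight : ∃ (m : ℝ → ℝ) (hm : MemLp (fun x => (m x : ℂ)) ⊤ volume),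
    (∀ x, ‖(m x : ℂ)‖ ≤ 1) ∧ ∀ q : ℝ, 2 < q → ∀ f : L2R,
      FarApprox (fun a => modL2 a (mulL2 hm (gaussL2 0))) q f := by
  obtain ⟨c, hc, hcq, hlim⟩ := exists_trigPoly_tendsto_one
  -- The weight `1 / (1 + σ)` makes the Gaussian dominate every `(1 - P_j) g`. Where the supremum is
  -- infinite (a null set) `σ` takes the value 0, so the weight is positive everywhere.
  let σ : ℝ → ℝ := fun x => ⨆ j, ‖1 - trigPoly (c j) x‖
  have hσ0 (x : ℝ) : 0 ≤ σ x := Real.iSup_nonneg fun j => norm_nonneg _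
  have hσm : Measurable σ := Measurable.iSup fun j =>
    (continuous_const.sub (continuous_trigPoly (c j))).norm.measurable
  let m : ℝ → ℝ := fun x => (1 + σ x)⁻¹
  have hm0 (x : ℝ) : 0 < m x := inv_pos.2 (by linarith [hσ0 x])
  have hm1 (x : ℝ) : ‖(m x : ℂ)‖ ≤ 1 := by
    rw [Complex.norm_real, Real.norm_of_nonneg (hm0 x).le]
    exact inv_le_one_of_one_le₀ (by linarith [hσ0 x])
  have hmm : Measurable fun x => (m x : ℂ) :=
    Complex.measurable_ofReal.comp ((measurable_const.add hσm).inv)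
  have hm : MemLp (fun x => (m x : ℂ)) ⊤ volume :=
    memLp_top_of_bound hmm.aestronglyMeasurable 1 (Eventually.of_forall hm1)
  refine ⟨m, hm, hm1, fun q hq f => ?_⟩
  set g := mulL2 hm (gaussL2 0) with hg
  have hgx := coeFn_mulL2 hm (gaussL2 0)
  rw [← hg] at hgx
  have hbdd (j : ℕ) : ∀ᵐ x, ‖1 - trigPoly (c j) x‖ * m x ≤ 1 := by
    filter_upwards [hlim] with x hx
    have hb : BddAbove (Set.range fun j => ‖1 - trigPoly (c j) x‖) :=
      ((tendsto_const_nhds.sub hx).norm).bddAbove_range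
    have h1 : ‖1 - trigPoly (c j) x‖ ≤ σ x := le_ciSup hb j
    rw [← div_eq_mul_inv, div_le_one (by linarith [hσ0 x])]
    linarith
  have hsub (j : ℕ) : (g - (c j).sum fun n a => a • modL2 n g : L2R) =ᵐ[volume]
      fun x => (1 - trigPoly (c j) x) * g x := by
    filter_upwards [Lp.coeFn_sub g ((c j).sum fun n a => a • modL2 n g),
      coeFn_sum_smul_modL2 (c j) g] with x h1 h2
    rw [h1, Pi.sub_apply, h2]
    ring
  have htend : Tendsto (fun j => ‖g - (c j).sum fun n a => a • modL2 n g‖) atTop (𝓝 0) := by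
    refine tendsto_norm_zero_of_dominated (G := gaussL2 0) (fun j => ?_) ?_
    · filter_upwards [hsub j, hbdd j, hgx] with x h1 h2 h3
      rw [h1, h3, ← mul_assoc, norm_mul, norm_mul, Complex.norm_real,
        Real.norm_of_nonneg (hm0 x).le]
      exact mul_le_of_le_one_left (norm_nonneg _) h2
    · filter_upwards [ae_all_iff.2 hsub, hlim] with x h1 h2
      simp only [h1]
      simpa using ((tendsto_const_nhds (x := (1 : ℂ))).sub h2).mul_const (g x)
  refine FarApprox.of_dense (by linarith) (farApprox_modL2 hc (hcq q hq) htend)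
    (span_modL2_topologicalClosure ?_) f
  filter_upwards [hgx, coeFn_gaussL2 0] with x h1 h2
  rw [h1, h2]
  exact mul_ne_zero (by exact_mod_cast (hm0 x).ne') (by exact_mod_cast (Real.exp_pos _).ne')

lemma IsUniformlyDiscrete.neg {ι : Type*} {Λ : ι → ℝ} (h : IsUniformlyDiscrete Λ) :
    IsUniformlyDiscrete fun n => -Λ n := by
  obtain ⟨δ, hδ, h⟩ := h
  refine ⟨δ, hδ, fun m n hmn => (h m n hmn).trans (le_of_eq ?_)⟩
  rw [neg_sub_neg, abs_sub_comm]

lemma inner_translateL2 (a : ℝ) (g f : L2R) :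
    inner ℂ (translateL2 a g) f = inner ℂ (modL2 a (𝓕 g)) (𝓕 f) := by
  rw [← fourier_translateL2, Lp.inner_fourier_eq]

/-! ### The obstruction to frames. -/

/-- The function `exp (π (x - N)²)` restricted to `[N, N + 1]`. -/
def invGaussCutoff (N : ℝ) : ℝ → ℂ :=
  (Set.Icc N (N + 1)).indicator fun x => ((rexp (π * (x - N) ^ 2) : ℝ) : ℂ)

lemma norm_invGaussCutoff_le (N x : ℝ) : ‖invGaussCutoff N x‖ ≤ rexp π := by
  unfold invGaussCutoff
  by_cases hx : x ∈ Set.Icc N (N + 1)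
  · rw [Set.indicator_of_mem hx, Complex.norm_real, Real.norm_of_nonneg (Real.exp_pos _).le,
      Real.exp_le_exp]
    have : (x - N) ^ 2 ≤ 1 := by nlinarith [hx.1, hx.2]
    nlinarith [pi_pos]
  · rw [Set.indicator_of_notMem hx, norm_zero]
    exact (Real.exp_pos _).le

lemma memLp_invGaussCutoff (N : ℝ) : MemLp (invGaussCutoff N) ⊤ volume := by
  refine memLp_top_of_bound ?_ (rexp π) (Eventually.of_forall (norm_invGaussCutoff_le N))
  exact (Continuous.aestronglyMeasurable (by fun_prop)).indicator measurableSet_Icc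

/-- The cutoffs are bounded by `exp π` uniformly in `N` and their supports escape to infinity, so
dominated convergence applies. -/
lemma tendsto_norm_mulL2_invGaussCutoff (h : L2R) :
    Tendsto (fun N : ℕ => ‖mulL2 (memLp_invGaussCutoff N) h‖) atTop (𝓝 0) := by
  refine tendsto_norm_zero_of_dominated (G := ((rexp π : ℝ) : ℂ) • h) (fun N => ?_) ?_
  · filter_upwards [coeFn_mulL2 (memLp_invGaussCutoff N) h,
      Lp.coeFn_smul ((rexp π : ℝ) : ℂ) h] with x h1 h2
    rw [h1, h2, Pi.smul_apply, smul_eq_mul, norm_mul, norm_mul, Complex.norm_real,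
      Real.norm_of_nonneg (Real.exp_pos _).le]
    exact mul_le_mul_of_nonneg_right (norm_invGaussCutoff_le _ _) (norm_nonneg _)
  · filter_upwards [ae_all_iff.2 fun N : ℕ => coeFn_mulL2 (memLp_invGaussCutoff N) h] with x hx
    refine tendsto_const_nhds.congr' ?_
    filter_upwards [eventually_gt_atTop ⌈x⌉₊] with N hN
    have : x < N := Nat.lt_of_ceil_lt hN
    rw [hx, invGaussCutoff, Set.indicator_of_notMem (fun h => by linarith [h.1]), zero_mul]

/-- The indicator function of `[N, N + 1]`. -/
def unitIndicatorL2 (N : ℝ) : L2R :=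
  indicatorConstLp 2 (measurableSet_Icc (a := N) (b := N + 1)) (by simp) 1

lemma norm_unitIndicatorL2 (N : ℝ) : ‖unitIndicatorL2 N‖ = 1 := by
  rw [unitIndicatorL2, norm_indicatorConstLp (by norm_num) (by norm_num)]
  simp

/-- The indicator is the Gaussian at `N` times its cut-off inverse. Shifting the inverse onto `h`
brings in the Gaussian system, whose Bessel constant is independent of `N`; swapping the roles of
the two functions changes `a` to `-a`. -/
lemma norm_inner_modL2_unitIndicatorL2 (a N : ℝ) (h : L2R) :
    ‖inner ℂ (modL2 a h) (unitIndicatorL2 N)‖ =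
      ‖inner ℂ (modL2 (-a) (gaussL2 N)) (mulL2 (memLp_invGaussCutoff N) h)‖ := by
  rw [norm_inner_symm]
  congr 1
  rw [unitIndicatorL2, L2.inner_indicatorConstLp_one, L2.inner_def,
    ← integral_indicator measurableSet_Icc]
  refine integral_congr_ae ?_
  filter_upwards [coeFn_modL2 a h, coeFn_modL2 (-a) (gaussL2 N), coeFn_gaussL2 N,
    coeFn_mulL2 (memLp_invGaussCutoff N) h] with x h1 h2 h3 h4
  rw [h2, h3, h4, invGaussCutoff]
  simp only [RCLike.inner_apply, map_mul, conj_modChar, neg_neg, Complex.conj_ofReal]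
  by_cases hx : x ∈ Set.Icc N (N + 1)
  · rw [Set.indicator_of_mem hx, Set.indicator_of_mem hx, h1]
    have : ((rexp (π * (x - N) ^ 2) : ℝ) : ℂ) * ((rexp (-π * (x - N) ^ 2) : ℝ) : ℂ) = 1 := by
      rw [← Complex.ofReal_mul, ← Real.exp_add]
      simp
    linear_combination (-(modChar a x * h x)) * this
  · rw [Set.indicator_of_notMem hx, Set.indicator_of_notMem hx]
    ring

/-- No uniformly discrete family of translates is a frame. -/
theorem not_isHilbertFrame_translateL2 {ι : Type*} {Λ : ι → ℝ} (hΛ : IsUniformlyDiscrete Λ)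
    (g : L2R) : ¬ IsHilbertFrame fun n => translateL2 (Λ n) g := by
  rintro ⟨A, B, hA, hAB⟩
  obtain ⟨K, hK0, hK⟩ := hΛ.neg.exists_bessel_gaussL2
  have hle (N : ℕ) : A ≤ K * ‖mulL2 (memLp_invGaussCutoff N) (𝓕 g)‖ ^ 2 := by
    obtain ⟨hs, h1, -⟩ := hAB (𝓕⁻ (unitIndicatorL2 N))
    have hn : ‖(𝓕⁻ (unitIndicatorL2 N) : L2R)‖ = 1 := by
      rw [← Lp.norm_fourier_eq, FourierTransform.fourier_fourierInv_eq, norm_unitIndicatorL2]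
    rw [hn, one_pow, mul_one] at h1
    refine h1.trans (hs.tsum_le_of_sum_le fun s => ?_)
    refine le_trans (le_of_eq (Finset.sum_congr rfl fun n _ => ?_)) (hK N _ s)
    rw [inner_translateL2, FourierTransform.fourier_fourierInv_eq,
      norm_inner_modL2_unitIndicatorL2]
  have hlim := ((tendsto_norm_mulL2_invGaussCutoff (𝓕 g)).pow 2).const_mul K
  have := ge_of_tendsto' hlim hle
  norm_num at this
  linarith

/-! ### Assembly of the quasi-frame. -/

/-- Some uniformly discrete sequence of translates is a quasi-frame. -/
theorem exists_isQuasiFrame_translateL2 : ∃ Λ : ℕ → ℝ, IsUniformlyDiscrete Λ ∧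
    ∃ g : L2R, IsQuasiFrame fun n => translateL2 (Λ n) g := by
  obtain ⟨m, hm, hm1, hfar⟩ := exists_weight
  have : Fact ((2 : ENNReal) ≠ ⊤) := ⟨ENNReal.ofNat_ne_top⟩
  obtain ⟨Λ, hΛ, hcomplete⟩ := exists_separated_isCompleteWithEstimate hfar
  have hF : 𝓕 (𝓕⁻ (mulL2 hm (gaussL2 0)) : L2R) = mulL2 hm (gaussL2 0) :=
    FourierTransform.fourier_fourierInv_eq _
  refine ⟨Λ, hΛ, 𝓕⁻ (mulL2 hm (gaussL2 0)), fun q hq => ?_, ?_⟩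
  · obtain ⟨C, hC⟩ := hcomplete q hq
    refine ⟨C, fun f ε hε => ?_⟩
    obtain ⟨c, hc1, hc2⟩ := hC (𝓕 f) ε hε
    refine ⟨c, ?_, by rwa [Lp.norm_fourier_eq] at hc2⟩
    refine lt_of_eq_of_lt ?_ hc1
    rw [← (Lp.fourierTransformₗᵢ ℝ ℂ).norm_map]
    refine congrArg norm ?_
    rw [map_sub, map_finsuppSum]
    congr 1
    refine Finsupp.sum_congr fun n _ => ?_
    rw [map_smul]
    exact congrArg _ ((fourier_translateL2 _ _).trans (by rw [hF]))
  · obtain ⟨K, hK0, hK⟩ := hΛ.exists_bessel_gaussL2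
    have hbound (f : L2R) (s : Finset ℕ) :
        ∑ n ∈ s, ‖inner ℂ (translateL2 (Λ n) (𝓕⁻ (mulL2 hm (gaussL2 0)))) f‖ ^ 2 ≤
          K * ‖f‖ ^ 2 := by
      -- The weight is real, so it moves to the other side of the inner product; being bounded by 1,
      -- it preserves the Gaussian Bessel bound.
      have h1 (n : ℕ) : inner ℂ (translateL2 (Λ n) (𝓕⁻ (mulL2 hm (gaussL2 0)))) f =
          inner ℂ (modL2 (Λ n) (gaussL2 0)) (mulL2 hm (𝓕 f)) := by
        rw [inner_translateL2, hF, L2.inner_def, L2.inner_def]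
        refine integral_congr_ae ?_
        filter_upwards [coeFn_modL2 (Λ n) (mulL2 hm (gaussL2 0)), coeFn_mulL2 hm (gaussL2 0),
          coeFn_modL2 (Λ n) (gaussL2 0), coeFn_mulL2 hm (𝓕 f)] with x h1 h2 h3 h4
        rw [h1, h2, h3, h4]
        simp only [RCLike.inner_apply, map_mul, Complex.conj_ofReal]
        ring
      simp only [h1]
      refine (hK 0 _ s).trans (mul_le_mul_of_nonneg_left ?_ hK0)
      rw [← Lp.norm_fourier_eq f]
      exact pow_le_pow_left₀ (norm_nonneg _) (norm_mulL2_le hm hm1 _) 2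
    refine ⟨√K, fun f => ?_⟩
    have hs := summable_of_sum_le (fun n => by positivity) (hbound f)
    refine ⟨hs, ?_⟩
    rw [Real.sqrt_le_left (by positivity), mul_pow, Real.sq_sqrt hK0]
    exact hs.tsum_le_of_sum_le (hbound f)

end

/-- Some uniformly discrete sequence of translates of some `g ∈ L²(ℝ)` is a quasi-frame, whereas
no uniformly discrete family of translates of any `g ∈ L²(ℝ)` is a frame. -/
theorem theorem1 :
    (∃ Λ : ℕ → ℝ, IsUniformlyDiscrete Λ ∧
      ∃ g : Lp ℂ 2 (volume : Measure ℝ), IsQuasiFrame (fun n => translateL2 (Λ n) g)) ∧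
    (∀ (ι : Type) (Λ : ι → ℝ), IsUniformlyDiscrete Λ →
      ∀ g : Lp ℂ 2 (volume : Measure ℝ), ¬ IsHilbertFrame (fun n => translateL2 (Λ n) g)) :=
  ⟨exists_isQuasiFrame_translateL2, fun _ _ hΛ g => not_isHilbertFrame_translateL2 hΛ g⟩
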